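/- Let $|\psi\rangle\in\mathbb{C}^2\otimes\mathbb{C}^2\otimes\mathbb{C}^2$ be a unit vector and $\rho_{123}=|\psi\rangle\langle\psi|$ the corresponding pure three-qubit state. For a two-qubit state $\rho_{kl}$ (the sender holding qubit $k$, the receiver qubit $l$) let $C(\rho_{kl})=1+S(\rho_l)-S(\rho_{kl})$ be its dense coding capacity, where $S(\rho)=-\mathrm{Tr}(\rho\log_2\rho)$ and $\rho_l=\mathrm{Tr}_k\,\rho_{kl}$. For a permutation $(j,k,l)$ of $(1,2,3)$ let $$C_{CD}^{jkl}(\rho_{123})=\max_{U}\sum_{i=0}^{1}\langle i|U\rho_jU^\dagger|i\rangle\,C(\rho_{kl}^i),$$ where the maximum is over all $2\times2$ unitary matrices $U$, $\rho_j$ is the reduced state of qubit $j$, and $\rho_{kl}^i$ is the state of qubits $k,l$ after outcome $i$ when qubit $j$ is measured in the orthonormal basis $\{U^\dagger|0\rangle,U^\dagger|1\rangle\}$ (an outcome of probability zero contributes $0$). Let $$P^{jkl}(\rho_{123})=C_{CD}^{jkl}(\rho_{123})-C(\rho_{kl}),\qquad \rho_{kl}=\mathrm{Tr}_j\,\rho_{123},$$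 and let the minimal control power be $P(\rho_{123})=\min_{j,k,l}P^{jkl}(\rho_{123})$, the minimum being over all permutations $(j,k,l)$ of $(1,2,3)$. Then $P(\rho_{123})=0$ if and only if $\rho_{123}$ is biseparable (that is, $|\psi\rangle$ is a tensor product of a vector of one of the three qubits and a vector of the other two) or fully separable (that is, $|\psi\rangle$ is a tensor product of three single-qubit vectors). -/

import Mathlib

noncomputable section

namespace DenseCoding

open Matrix
open scoped Kronecker ComplexOrder

/-- The von Neumann entropy `S(ρ) = -Tr (ρ log₂ ρ)`, in bits. The logarithm of the Hermitian
matrix `ρ` is the functional calculus of `Real.logb 2`; since `Real.logb 2 0 = 0`, the kernel of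
`ρ` contributes `0 · log₂ 0 = 0`. -/
def entropy {n : Type*} [Fintype n] [DecidableEq n] (ρ : Matrix n n ℂ) : ℝ :=
  -(ρ * cfc (Real.logb 2) ρ).trace.re

/-- Partial trace over the first tensor factor. -/
def traceFst {m n : Type*} [Fintype m] (ρ : Matrix (m × n) (m × n) ℂ) : Matrix n n ℂ :=
  Matrix.of fun a b => ∑ i, ρ (i, a) (i, b)

/-- Partial trace over the second tensor factor. -/
def traceSnd {m n : Type*} [Fintype n] (ρ : Matrix (m × n) (m × n) ℂ) : Matrix m m ℂ :=
  Matrix.of fun a b => ∑ i, ρ (a, i) (b, i)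

/-- The dense coding capacity `C(ρ) = 1 + S(ρ_B) - S(ρ)` of a two-qubit state, where Alice (the
sender) has the first and Bob (the receiver) the second qubit. -/
def capacity (ρ : Matrix (Fin 2 × Fin 2) (Fin 2 × Fin 2) ℂ) : ℝ :=
  1 + entropy (traceFst ρ) - entropy ρ

/-- The operator `(U ⊗ 1) ρ (U ⊗ 1)†` on (Charlie) ⊗ (Alice ⊗ Bob). -/
def rotate (U : Matrix (Fin 2) (Fin 2) ℂ)
    (ρ : Matrix (Fin 2 × (Fin 2 × Fin 2)) (Fin 2 × (Fin 2 × Fin 2)) ℂ) :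
    Matrix (Fin 2 × (Fin 2 × Fin 2)) (Fin 2 × (Fin 2 × Fin 2)) ℂ :=
  (U ⊗ₖ (1 : Matrix (Fin 2 × Fin 2) (Fin 2 × Fin 2) ℂ)) * ρ *
    (U ⊗ₖ (1 : Matrix (Fin 2 × Fin 2) (Fin 2 × Fin 2) ℂ))ᴴ

/-- The probability `⟨i| U ρ_C U† |i⟩` of Charlie's outcome `i`, where Charlie has the first of
the three qubits and `ρ_C` is its reduced state. -/
def outcomeProb (U : Matrix (Fin 2) (Fin 2) ℂ)
    (ρ : Matrix (Fin 2 × (Fin 2 × Fin 2)) (Fin 2 × (Fin 2 × Fin 2)) ℂ) (i : Fin 2) : ℝ :=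
  ((U * traceSnd ρ * Uᴴ) i i).re

/-- The state shared by Alice and Bob after Charlie's outcome `i`: the normalization of
`⟨i|_C (U ⊗ 1) ρ (U ⊗ 1)† |i⟩_C`. (If the outcome has probability zero this is the zero matrix;
it then enters the average capacity with weight zero.) -/
def postState (U : Matrix (Fin 2) (Fin 2) ℂ)
    (ρ : Matrix (Fin 2 × (Fin 2 × Fin 2)) (Fin 2 × (Fin 2 × Fin 2)) ℂ) (i : Fin 2) :
    Matrix (Fin 2 × Fin 2) (Fin 2 × Fin 2) ℂ :=
  (outcomeProb U ρ i)⁻¹ • (rotate U ρ).submatrix (Prod.mk i) (Prod.mk i)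

/-- The average dense coding capacity when Charlie measures in the basis given by `U`. -/
def avgCapacity (U : Matrix (Fin 2) (Fin 2) ℂ)
    (ρ : Matrix (Fin 2 × (Fin 2 × Fin 2)) (Fin 2 × (Fin 2 × Fin 2)) ℂ) : ℝ :=
  ∑ i, outcomeProb U ρ i * capacity (postState U ρ i)

/-- The controlled dense coding capacity: the maximum of the average capacity over all `2 × 2`
unitary matrices. The supremum is attained, see `controlledCapacity_isGreatest`. -/
def controlledCapacity
    (ρ : Matrix (Fin 2 × (Fin 2 × Fin 2)) (Fin 2 × (Fin 2 × Fin 2)) ℂ) : ℝ :=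
  ⨆ U : Matrix.unitaryGroup (Fin 2) ℂ, avgCapacity (U : Matrix (Fin 2) (Fin 2) ℂ) ρ

/-- Reorder the qubits of a three-qubit state as (Charlie, Alice, Bob), where Charlie has qubit
`σ 0`, Alice has qubit `σ 1` and Bob has qubit `σ 2`. A basis vector of the three qubits is
labelled by `x : Fin 3 → Fin 2`, `x q` being the label of qubit `q`. -/
def arrange (σ : Equiv.Perm (Fin 3)) (ρ : Matrix (Fin 3 → Fin 2) (Fin 3 → Fin 2) ℂ) :
    Matrix (Fin 2 × (Fin 2 × Fin 2)) (Fin 2 × (Fin 2 × Fin 2)) ℂ :=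
  ρ.submatrix (fun y q => ![y.1, y.2.1, y.2.2] (σ.symm q))
    (fun y q => ![y.1, y.2.1, y.2.2] (σ.symm q))

/-- The control power of Charlie for the distribution `σ` of the qubits: the controlled dense
coding capacity minus the capacity of the reduced state of Alice and Bob. -/
def controlPower (σ : Equiv.Perm (Fin 3)) (ρ : Matrix (Fin 3 → Fin 2) (Fin 3 → Fin 2) ℂ) : ℝ :=
  controlledCapacity (arrange σ ρ) - capacity (traceFst (arrange σ ρ))

/-- The minimal control power: the minimum of the control power over all permutations. -/
def minControlPower (ρ : Matrix (Fin 3 → Fin 2) (Fin 3 → Fin 2) ℂ) : ℝ :=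
  Finset.univ.inf' Finset.univ_nonempty fun σ : Equiv.Perm (Fin 3) => controlPower σ ρ

/-- The density matrix `|ψ⟩⟨ψ|`. -/
def pureState {n : Type*} (ψ : EuclideanSpace ℂ n) : Matrix n n ℂ :=
  Matrix.vecMulVec (fun x => ψ x) (fun x => star (ψ x))

/-- A three-qubit state vector is biseparable if it is a tensor product of a vector of one of the
qubits and a vector of the other two (which may or may not be entangled). -/
def IsBiseparable (ψ : EuclideanSpace ℂ (Fin 3 → Fin 2)) : Prop :=
  ∃ (σ : Equiv.Perm (Fin 3)) (a : Fin 2 → ℂ) (b : Fin 2 × Fin 2 → ℂ),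
    ∀ x : Fin 3 → Fin 2, ψ x = a (x (σ 0)) * b (x (σ 1), x (σ 2))

/-- A three-qubit state vector is fully separable if it is a tensor product of three vectors of
the single qubits. -/
def IsFullySeparable (ψ : EuclideanSpace ℂ (Fin 3 → Fin 2)) : Prop :=
  ∃ a b c : Fin 2 → ℂ, ∀ x : Fin 3 → Fin 2, ψ x = a (x 0) * b (x 1) * c (x 2)

/-! The maximum over Charlie's measurement bases exists. -/

/-- `Tr (ρ log₂ ρ)` as the trace of a functional calculus. -/
def trLog {n : Type*} [Fintype n] [DecidableEq n] (ρ : Matrix n n ℂ) : ℝ :=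
  (cfc (fun x : ℝ => x * Real.logb 2 x) ρ).trace.re

theorem continuousOn_of_finite_spectrum {n : Type*} [Fintype n] [DecidableEq n]
    (f : ℝ → ℝ) (ρ : Matrix n n ℂ) : ContinuousOn f (spectrum ℝ ρ) :=
  Set.Finite.continuousOn (Matrix.finite_real_spectrum (A := ρ)) f

theorem entropy_eq_neg_trLog {n : Type*} [Fintype n] [DecidableEq n] {ρ : Matrix n n ℂ}
    (h : ρ.IsHermitian) : entropy ρ = -trLog ρ := by
  have hs : IsSelfAdjoint ρ := h
  unfold entropy trLog
  rw [cfc_mul (fun x : ℝ => x) (Real.logb 2) ρ (continuousOn_of_finite_spectrum _ _)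
    (continuousOn_of_finite_spectrum _ _), cfc_id' ℝ ρ]

theorem entropy_smul {n : Type*} [Fintype n] [DecidableEq n] {ρ : Matrix n n ℂ}
    (h : ρ.IsHermitian) {c : ℝ} (hc : c ≠ 0) :
    entropy (c • ρ) = -(c * trLog ρ + c * Real.logb 2 c * ρ.trace.re) := by
  have hs : IsSelfAdjoint ρ := h
  have hcs : IsSelfAdjoint (c • ρ) := IsSelfAdjoint.smul (IsSelfAdjoint.all c) hs
  rw [entropy_eq_neg_trLog hcs]
  congr 1
  unfold trLog
  rw [← cfc_comp_smul c (fun x : ℝ => x * Real.logb 2 x) ρ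
    ((Set.Finite.image _ (Matrix.finite_real_spectrum (A := ρ))).continuousOn _)]
  have : (fun x : ℝ => c • x * Real.logb 2 (c • x)) =
      fun x : ℝ => c • (x * Real.logb 2 x) + (c * Real.logb 2 c) • x := by
    funext x
    rcases eq_or_ne x 0 with rfl | hx
    · simp
    · simp only [smul_eq_mul, Real.logb_mul hc hx]; ring
  rw [this, cfc_add ρ _ _ (continuousOn_of_finite_spectrum _ _)
    (continuousOn_of_finite_spectrum _ _), cfc_smul _ _ ρ (continuousOn_of_finite_spectrum _ _),
    cfc_smul _ _ ρ (continuousOn_of_finite_spectrum _ _), cfc_id' ℝ ρ]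
  simp [Matrix.trace_add, Matrix.trace_smul]

open scoped Matrix.Norms.L2Operator in
theorem continuous_trLog {X n : Type*} [TopologicalSpace X] [Fintype n] [DecidableEq n]
    {f : X → Matrix n n ℂ} (hf : Continuous f) (h : ∀ x, (f x).IsHermitian) :
    Continuous fun x => trLog (f x) := by
  have hc : Continuous fun x : ℝ => x * Real.logb 2 x := by
    have : (fun x : ℝ => x * Real.logb 2 x) = fun x => x * Real.log x / Real.log 2 := by
      funext x; simp [Real.logb, mul_div_assoc]
    rw [this]
    exact Real.continuous_mul_log.div_const _
  have h1 : Continuous fun x => cfc (fun x : ℝ => x * Real.logb 2 x) (f x) :=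
    Continuous.cfc_of_mem_nhdsSet (s := Set.univ) (fun x : ℝ => x * Real.logb 2 x)
      Filter.univ_mem hf (fun x => h x) hc.continuousOn
  exact Complex.continuous_re.comp h1.matrix_trace

theorem posSemidef_rotate {ρ : Matrix (Fin 2 × (Fin 2 × Fin 2)) (Fin 2 × (Fin 2 × Fin 2)) ℂ}
    (hρ : ρ.PosSemidef) (U : Matrix (Fin 2) (Fin 2) ℂ) : (rotate U ρ).PosSemidef :=
  hρ.mul_mul_conjTranspose_same _

theorem isHermitian_traceFst {m n : Type*} [Fintype m] {ρ : Matrix (m × n) (m × n) ℂ}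
    (hρ : ρ.IsHermitian) : (traceFst ρ).IsHermitian := by
  ext a b
  simp only [traceFst, Matrix.conjTranspose_apply, Matrix.of_apply, star_sum]
  exact Finset.sum_congr rfl fun i _ => hρ.apply _ _

theorem trace_traceFst {m n : Type*} [Fintype m] [Fintype n] (ρ : Matrix (m × n) (m × n) ℂ) :
    (traceFst ρ).trace = ρ.trace := by
  simp only [Matrix.trace, traceFst, Matrix.diag_apply, Matrix.of_apply, Fintype.sum_prod_type]
  exact Finset.sum_comm

theorem traceFst_smul {m n : Type*} [Fintype m] (c : ℝ) (ρ : Matrix (m × n) (m × n) ℂ) :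
    traceFst (c • ρ) = c • traceFst ρ := by
  ext a b
  simp [traceFst, Finset.mul_sum]

theorem outcomeProb_eq_trace (U : Matrix (Fin 2) (Fin 2) ℂ)
    (ρ : Matrix (Fin 2 × (Fin 2 × Fin 2)) (Fin 2 × (Fin 2 × Fin 2)) ℂ) (i : Fin 2) :
    outcomeProb U ρ i = ((rotate U ρ).submatrix (Prod.mk i) (Prod.mk i)).trace.re := by
  unfold outcomeProb rotate
  congr 1
  simp only [Matrix.trace, Matrix.diag_apply, Matrix.submatrix_apply, Matrix.mul_apply, traceSnd,
    Matrix.of_apply, Matrix.conjTranspose_apply, Matrix.kroneckerMap_apply, Matrix.one_apply,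
    Fintype.sum_prod_type, Fin.sum_univ_two]
  simp
  ring

theorem outcomeProb_mul_capacity
    {ρ : Matrix (Fin 2 × (Fin 2 × Fin 2)) (Fin 2 × (Fin 2 × Fin 2)) ℂ}
    (hρ : ρ.PosSemidef) (U : Matrix (Fin 2) (Fin 2) ℂ) (i : Fin 2) :
    outcomeProb U ρ i * capacity (postState U ρ i) =
      outcomeProb U ρ i + trLog ((rotate U ρ).submatrix (Prod.mk i) (Prod.mk i))
        - trLog (traceFst ((rotate U ρ).submatrix (Prod.mk i) (Prod.mk i))) := by
  have hσ : ((rotate U ρ).submatrix (Prod.mk i) (Prod.mk i)).PosSemidef :=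
    (posSemidef_rotate hρ U).submatrix _
  have hp := outcomeProb_eq_trace U ρ i
  unfold capacity postState
  generalize (rotate U ρ).submatrix (Prod.mk i) (Prod.mk i) = τ at *
  rcases eq_or_ne (outcomeProb U ρ i) 0 with h0 | h0
  · have ht : τ.trace = 0 := by
      apply Complex.ext
      · rw [← hp, h0]; rfl
      · exact (Complex.le_def.1 hσ.trace_nonneg).2.symm
    have hz : τ = 0 := hσ.trace_eq_zero_iff.1 ht
    have hz' : traceFst τ = 0 := by
      rw [hz]; ext a b; simp [traceFst]
    rw [h0, hz', hz]
    simp [trLog]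
  · rw [traceFst_smul, entropy_smul (isHermitian_traceFst hσ.isHermitian) (inv_ne_zero h0),
      entropy_smul hσ.isHermitian (inv_ne_zero h0), trace_traceFst]
    field_simp
    ring

theorem continuous_avgCapacity
    {ρ : Matrix (Fin 2 × (Fin 2 × Fin 2)) (Fin 2 × (Fin 2 × Fin 2)) ℂ} (hρ : ρ.PosSemidef) :
    Continuous fun U : Matrix (Fin 2) (Fin 2) ℂ => avgCapacity U ρ := by
  have hr : Continuous fun U : Matrix (Fin 2) (Fin 2) ℂ => rotate U ρ := by
    have hk : Continuous fun U : Matrix (Fin 2) (Fin 2) ℂ =>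
        U ⊗ₖ (1 : Matrix (Fin 2 × Fin 2) (Fin 2 × Fin 2) ℂ) := by
      refine continuous_matrix fun a b => ?_
      simp only [Matrix.kroneckerMap_apply]
      exact (continuous_id.matrix_elem _ _).mul continuous_const
    exact (hk.matrix_mul continuous_const).matrix_mul hk.matrix_conjTranspose
  have hs : ∀ i : Fin 2, Continuous fun U : Matrix (Fin 2) (Fin 2) ℂ =>
      (rotate U ρ).submatrix (Prod.mk i) (Prod.mk i) := fun i => hr.matrix_submatrix _ _
  have ht : ∀ i : Fin 2, Continuous fun U : Matrix (Fin 2) (Fin 2) ℂ =>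
      traceFst ((rotate U ρ).submatrix (Prod.mk i) (Prod.mk i)) := fun i =>
    continuous_matrix fun a b => by
      simp only [traceFst, Matrix.of_apply]
      exact continuous_finsetSum _ fun c _ => (hs i).matrix_elem (c, a) (c, b)
  have hh : ∀ (i : Fin 2) (U : Matrix (Fin 2) (Fin 2) ℂ),
      ((rotate U ρ).submatrix (Prod.mk i) (Prod.mk i)).IsHermitian := fun i U =>
    ((posSemidef_rotate hρ U).submatrix _).isHermitian
  unfold avgCapacity
  refine continuous_finsetSum _ fun i _ => ?_
  simp only [outcomeProb_mul_capacity hρ]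
  simp only [outcomeProb_eq_trace]
  exact ((Complex.continuous_re.comp (hs i).matrix_trace).add
    (continuous_trLog (hs i) (hh i))).sub
    (continuous_trLog (ht i) fun U => isHermitian_traceFst (hh i U))

open scoped Matrix.Norms.Elementwise in
theorem isCompact_unitaryGroup :
    IsCompact (Matrix.unitaryGroup (Fin 2) ℂ : Set (Matrix (Fin 2) (Fin 2) ℂ)) := by
  refine Metric.isCompact_of_isClosed_isBounded ?_ ?_
  · have : (Matrix.unitaryGroup (Fin 2) ℂ : Set (Matrix (Fin 2) (Fin 2) ℂ)) =
        {U | U * Uᴴ = 1} := by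
      ext U; exact Matrix.mem_unitaryGroup_iff
    rw [this]
    exact isClosed_eq (continuous_id.matrix_mul continuous_id.matrix_conjTranspose)
      continuous_const
  · refine isBounded_iff_forall_norm_le.2 ⟨1, fun U hU => ?_⟩
    exact entrywise_sup_norm_bound_of_unitary hU

/-- The supremum over Charlie's measurement bases is a maximum. -/
theorem controlledCapacity_isGreatest
    {ρ : Matrix (Fin 2 × (Fin 2 × Fin 2)) (Fin 2 × (Fin 2 × Fin 2)) ℂ} (hρ : ρ.PosSemidef) :
    IsGreatest (Set.range fun U : Matrix.unitaryGroup (Fin 2) ℂ =>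
      avgCapacity (U : Matrix (Fin 2) (Fin 2) ℂ) ρ) (controlledCapacity ρ) := by
  have : CompactSpace (Matrix.unitaryGroup (Fin 2) ℂ) :=
    isCompact_iff_compactSpace.1 isCompact_unitaryGroup
  exact (isCompact_range ((continuous_avgCapacity hρ).comp continuous_subtype_val)).isGreatest_sSup
    (Set.range_nonempty _)

end DenseCoding

end

/-!
Give an unnormalised vector `v` of Alice and Bob the weight `E(v)`, its entanglement entropy times
`‖v‖²`. Charlie's measurement leaves vectors `v₀`, `v₁` with average capacity `1 + E(v₀) + E(v₁)`.
If he measures in an eigenbasis of his reduced state, the gain over the capacity of the reduced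
state of Alice and Bob is `Tr (σ₀ + σ₁) log (σ₀ + σ₁) - Tr σ₀ log σ₀ - Tr σ₁ log σ₁`, where `σᵢ` is
Bob's part of `vᵢ`. This is nonnegative by Schur's inequality: some Gram matrix has, up to zeros,
the spectrum of `σ₀ + σ₁`, and has the eigenvalues of `σ₀` and `σ₁` on its diagonal. Equality forces
the Gram matrix to be diagonal, that is, `σ₀ σ₁ = 0`.

If the control power vanishes, then either some `vᵢ` is zero and Charlie's qubit factors out, or
`σ₀` and `σ₁` are both singular and `v₀`, `v₁` are product vectors. In the latter case the capacity
without Charlie's help is already `1`, so no measurement leaves any entanglement. Hence all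
superpositions of the two slices of the state along Charlie's qubit are product vectors, and two
`2 × 2` matrices of rank at most one whose sum is singular have a common factor.
-/

namespace DenseCoding

open Matrix
open scoped Kronecker ComplexOrder

/-- The function `x ↦ x log₂ x`, whose functional calculus has trace `trLog`. -/
noncomputable def xlog (x : ℝ) : ℝ := x * Real.logb 2 x

theorem xlog_zero : xlog 0 = 0 := zero_mul _

theorem xlog_mul (x y : ℝ) : xlog (x * y) = x * xlog y + y * xlog x := by
  rcases eq_or_ne x 0 with rfl | hx
  · simp [xlog]
  rcases eq_or_ne y 0 with rfl | hy
  · simp [xlog]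
  simp only [xlog, Real.logb_mul hx hy]
  ring

theorem strictConvexOn_xlog : StrictConvexOn ℝ (Set.Ici 0) xlog := by
  have hlog : 0 < Real.log 2 := Real.log_pos one_lt_two
  have hxlog : ∀ x, xlog x = x * Real.log x / Real.log 2 := fun x => (mul_div_assoc _ _ _).symm
  refine ⟨convex_Ici 0, fun x hx y hy hxy a b ha hb hab => ?_⟩
  have h := Real.strictConvexOn_mul_log.2 hx hy hxy ha hb hab
  simp only [smul_eq_mul] at h
  simp only [smul_eq_mul, hxlog, ← mul_div_assoc, ← add_div]
  exact div_lt_div_of_pos_right h hlog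

section SumXlog

variable {ι : Type*} [Fintype ι] {x : ι → ℝ}

theorem xlog_le_mul_logb_sum (hx : ∀ i, 0 ≤ x i) (i : ι) :
    xlog (x i) ≤ x i * Real.logb 2 (∑ j, x j) := by
  rcases (hx i).eq_or_lt with h | h
  · simp [xlog, ← h]
  · have hle : x i ≤ ∑ j, x j := Finset.single_le_sum (fun j _ => hx j) (Finset.mem_univ i)
    exact mul_le_mul_of_nonneg_left (Real.logb_le_logb_of_le one_lt_two h hle) h.le

theorem sum_xlog_le_xlog_sum (hx : ∀ i, 0 ≤ x i) : ∑ i, xlog (x i) ≤ xlog (∑ i, x i) := by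
  rw [xlog, Finset.sum_mul]
  exact Finset.sum_le_sum fun i _ => xlog_le_mul_logb_sum hx i

theorem mul_eq_zero_of_xlog_sum_le (hx : ∀ i, 0 ≤ x i)
    (h : xlog (∑ i, x i) ≤ ∑ i, xlog (x i)) {i j : ι} (hij : i ≠ j) : x i * x j = 0 := by
  classical
  have heq : ∀ k, xlog (x k) = x k * Real.logb 2 (∑ l, x l) := by
    have hsum := (sum_xlog_le_xlog_sum hx).antisymm h
    rw [xlog, Finset.sum_mul] at hsum
    simpa using (Finset.sum_eq_sum_iff_of_le fun k _ => xlog_le_mul_logb_sum hx k).1 hsum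
  have hmax : ∀ k, x k ≠ 0 → x k = ∑ l, x l := fun k hk =>
    Real.logb_injOn_pos one_lt_two ((hx k).lt_of_ne' hk)
      (Finset.sum_pos' (fun l _ => hx l) ⟨k, Finset.mem_univ k, (hx k).lt_of_ne' hk⟩)
      (mul_left_cancel₀ hk (heq k))
  by_contra hne
  have hi := left_ne_zero_of_mul hne
  have hj := right_ne_zero_of_mul hne
  have hpair : x i + x j ≤ ∑ l, x l := by
    rw [← Finset.sum_pair hij]
    exact Finset.sum_le_univ_sum_of_nonneg hx
  exact hj (le_antisymm (by linarith [hmax i hi]) (hx j))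

end SumXlog

section Schur

variable {n : Type*} [Fintype n] [DecidableEq n]

theorem sum_mul_star_of_mem_unitaryGroup {U : Matrix n n ℂ} (hU : U ∈ unitaryGroup n ℂ) (i k : n) :
    ∑ j, U i j * star (U k j) = if i = k then 1 else 0 := by
  simpa [Matrix.mul_apply, Matrix.one_apply] using
    congrFun (congrFun (mem_unitaryGroup_iff.1 hU) i) k

theorem sum_norm_sq_row {U : Matrix n n ℂ} (hU : U ∈ unitaryGroup n ℂ) (i : n) :
    ∑ j, ‖U i j‖ ^ 2 = 1 := by
  have h := sum_mul_star_of_mem_unitaryGroup hU i i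
  simp only [Complex.star_def, Complex.mul_conj', if_true] at h
  exact_mod_cast h

theorem sum_norm_sq_col {U : Matrix n n ℂ} (hU : U ∈ unitaryGroup n ℂ) (j : n) :
    ∑ i, ‖U i j‖ ^ 2 = 1 := by
  simpa using sum_norm_sq_row (Unitary.star_mem hU) j

variable {A : Matrix n n ℂ} (hA : A.IsHermitian) {f : ℝ → ℝ} {s : Set ℝ}

theorem apply_eq_sum_eigenvalues (i k : n) :
    A i k = ∑ j, hA.eigenvectorUnitary.1 i j * hA.eigenvalues j *
      star (hA.eigenvectorUnitary.1 k j) := by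
  conv_lhs => rw [hA.spectral_theorem, Unitary.conjStarAlgAut_apply]
  simp [Matrix.mul_apply, Matrix.diagonal_apply]

theorem diag_re_eq_sum_eigenvalues (i : n) :
    (A i i).re = ∑ j, ‖hA.eigenvectorUnitary.1 i j‖ ^ 2 * hA.eigenvalues j := by
  rw [apply_eq_sum_eigenvalues hA, Complex.re_sum]
  refine Finset.sum_congr rfl fun j _ => ?_
  rw [mul_right_comm, Complex.star_def, Complex.mul_conj']
  norm_cast

theorem sum_sum_norm_sq_mul_eigenvalues :
    ∑ i, ∑ j, ‖hA.eigenvectorUnitary.1 i j‖ ^ 2 * f (hA.eigenvalues j) =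
      ∑ j, f (hA.eigenvalues j) := by
  rw [Finset.sum_comm]
  simp only [← Finset.sum_mul, sum_norm_sq_col hA.eigenvectorUnitary.2, one_mul]

theorem map_diag_le_sum (hf : ConvexOn ℝ s f) (hs : ∀ j, hA.eigenvalues j ∈ s) (i : n) :
    f (A i i).re ≤ ∑ j, ‖hA.eigenvectorUnitary.1 i j‖ ^ 2 * f (hA.eigenvalues j) := by
  rw [diag_re_eq_sum_eigenvalues hA]
  exact hf.map_sum_le (fun j _ => by positivity) (sum_norm_sq_row hA.eigenvectorUnitary.2 i)
    fun j _ => hs j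

theorem sum_map_diag_le_sum_map_eigenvalues (hf : ConvexOn ℝ s f)
    (hs : ∀ j, hA.eigenvalues j ∈ s) : ∑ i, f (A i i).re ≤ ∑ j, f (hA.eigenvalues j) :=
  (Finset.sum_le_sum fun i _ => map_diag_le_sum hA hf hs i).trans_eq
    (sum_sum_norm_sq_mul_eigenvalues hA)

/-- Jensen's inequality is sharp in each row `i`, so all eigenvectors with a nonzero `i`-th entry
share one eigenvalue. -/
theorem isDiag_of_sum_map_eigenvalues_le (hf : StrictConvexOn ℝ s f)
    (hs : ∀ j, hA.eigenvalues j ∈ s) (h : ∑ j, f (hA.eigenvalues j) ≤ ∑ i, f (A i i).re) :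
    A.IsDiag := by
  intro i k hik
  set U := hA.eigenvectorUnitary.1
  have hU : U ∈ unitaryGroup n ℂ := hA.eigenvectorUnitary.2
  have hsharp : f (A i i).re = ∑ j, ‖U i j‖ ^ 2 * f (hA.eigenvalues j) := by
    have hle := fun i (_ : i ∈ Finset.univ) => map_diag_le_sum hA hf.convexOn hs i
    refine (Finset.sum_eq_sum_iff_of_le hle).1 ((Finset.sum_le_sum hle).antisymm ?_) i
      (Finset.mem_univ i)
    rwa [sum_sum_norm_sq_mul_eigenvalues hA]
  rw [diag_re_eq_sum_eigenvalues hA] at hsharp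
  have hconst := (hf.map_sum_eq_iff_of_nonneg (fun j _ => by positivity)
    (sum_norm_sq_row hU i) fun j _ => hs j).1 hsharp
  obtain ⟨l, hl⟩ : ∃ l, U i l ≠ 0 := by
    by_contra! hzero
    simpa [hzero] using sum_norm_sq_row hU i
  have hterm : ∀ j, U i j * hA.eigenvalues j = hA.eigenvalues l * U i j := fun j => by
    rcases eq_or_ne (U i j) 0 with hj | hj
    · simp [hj]
    · rw [hconst (Finset.mem_univ j) (by simpa using hj) (Finset.mem_univ l) (by simpa using hl),
        mul_comm]
  rw [apply_eq_sum_eigenvalues hA]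
  simp only [U, hterm, mul_assoc, ← Finset.mul_sum]
  rw [sum_mul_star_of_mem_unitaryGroup hU, if_neg hik, mul_zero]

end Schur

section TrLog

variable {m n : Type*} [Fintype m] [DecidableEq m] [Fintype n] [DecidableEq n]

theorem trLog_eq_sum_xlog_eigenvalues {A : Matrix n n ℂ} (hA : A.IsHermitian) :
    trLog A = ∑ i, xlog (hA.eigenvalues i) := by
  change (cfc xlog A).trace.re = _
  rw [hA.cfc_eq, Matrix.IsHermitian.cfc, Unitary.conjStarAlgAut_apply, Matrix.trace_mul_cycle]
  simp [Matrix.trace]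

theorem trLog_eq_sum_roots_charpoly {A : Matrix n n ℂ} (hA : A.IsHermitian) :
    trLog A = (A.charpoly.roots.map fun z => xlog z.re).sum := by
  rw [trLog_eq_sum_xlog_eigenvalues hA, hA.roots_charpoly_eq_eigenvalues, Multiset.map_map]
  rfl

theorem trLog_diagonal (d : n → ℝ) : trLog (diagonal fun i => (d i : ℂ)) = ∑ i, xlog (d i) := by
  have hd : (diagonal fun i => (d i : ℂ)).IsHermitian := by
    simp [Matrix.IsHermitian, diagonal_conjTranspose, Pi.star_def]
  rw [trLog_eq_sum_roots_charpoly hd, charpoly_diagonal, Polynomial.roots_prod _ _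
    (Finset.prod_ne_zero_iff.2 fun i _ => Polynomial.X_sub_C_ne_zero _)]
  simp

theorem trLog_mul_conjTranspose (M : Matrix m n ℂ) : trLog (M * Mᴴ) = trLog (Mᴴ * M) := by
  have hroots := congrArg (fun p => (p.roots.map fun z => xlog z.re).sum)
    (charpoly_mul_comm' M Mᴴ)
  have hne : ∀ {k : ℕ} {p : Polynomial ℂ}, p.Monic → Polynomial.X ^ k * p ≠ 0 := fun hp =>
    ((Polynomial.monic_X_pow _).mul hp).ne_zero
  rw [Polynomial.roots_mul (hne (charpoly_monic _)), Polynomial.roots_mul (hne (charpoly_monic _))]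
    at hroots
  rw [trLog_eq_sum_roots_charpoly (isHermitian_mul_conjTranspose_self M),
    trLog_eq_sum_roots_charpoly (isHermitian_conjTranspose_mul_self M)]
  simpa [Multiset.map_nsmul, Multiset.sum_nsmul, xlog_zero] using hroots

theorem exists_mul_conjTranspose_eq {A : Matrix n n ℂ} (hA : A.PosSemidef) :
    ∃ Y : Matrix n n ℂ, Y * Yᴴ = A ∧
      Yᴴ * Y = diagonal fun i => (hA.isHermitian.eigenvalues i : ℂ) := by
  set U := hA.isHermitian.eigenvectorUnitary
  set D : Matrix n n ℂ := diagonal fun i => (√(hA.isHermitian.eigenvalues i) : ℂ)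
  have hD : Dᴴ = D := by simp [D, diagonal_conjTranspose, Pi.star_def]
  have hDD : D * D = diagonal fun i => (hA.isHermitian.eigenvalues i : ℂ) := by
    simp only [D, diagonal_mul_diagonal, ← Complex.ofReal_mul,
      Real.mul_self_sqrt (hA.eigenvalues_nonneg _)]
  refine ⟨U.1 * D, ?_, ?_⟩
  · conv_rhs => rw [hA.isHermitian.spectral_theorem, Unitary.conjStarAlgAut_apply]
    rw [conjTranspose_mul, hD, Matrix.mul_assoc, ← Matrix.mul_assoc D, hDD, Matrix.mul_assoc]
    rfl
  · rw [conjTranspose_mul, hD, Matrix.mul_assoc, ← Matrix.mul_assoc U.1ᴴ, ← star_eq_conjTranspose,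
      mem_unitaryGroup_iff'.1 U.2, Matrix.one_mul, hDD]

theorem trLog_smul {A : Matrix n n ℂ} (hA : A.IsHermitian) (c : ℝ) :
    trLog (c • A) = c * trLog A + xlog c * A.trace.re := by
  rcases eq_or_ne c 0 with rfl | hc
  · simp [trLog, xlog]
  · rw [← neg_inj, ← entropy_eq_neg_trLog (hA.smul (IsSelfAdjoint.all c)), entropy_smul hA hc, xlog]

/-- The unnormalised pure state `|v⟩⟨v|`. -/
def ketBra {n : Type*} (v : n → ℂ) : Matrix n n ℂ := vecMulVec v (star v)

theorem trace_ketBra {n : Type*} [Fintype n] (v : n → ℂ) :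
    (ketBra v).trace = ((∑ x, ‖v x‖ ^ 2 : ℝ) : ℂ) := by
  simp [ketBra, trace_vecMulVec, dotProduct, Complex.mul_conj']

theorem posSemidef_ketBra {n : Type*} [Finite n] (v : n → ℂ) : (ketBra v).PosSemidef :=
  posSemidef_vecMulVec_self_star v

theorem ketBra_smul {n : Type*} (c : ℂ) (v : n → ℂ) : ketBra (c • v) = ‖c‖ ^ 2 • ketBra v := by
  ext x y
  simp [ketBra, vecMulVec_apply, ← Complex.mul_conj']
  ring

theorem trLog_ketBra (v : n → ℂ) : trLog (ketBra v) = xlog (ketBra v).trace.re := by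
  have hinner : (replicateCol Unit v)ᴴ * replicateCol Unit v =
      diagonal fun _ => ((∑ x, ‖v x‖ ^ 2 : ℝ) : ℂ) := by
    ext
    simp [Matrix.mul_apply, Complex.conj_mul']
  rw [trace_ketBra, Complex.ofReal_re, ketBra, vecMulVec_eq Unit, ← conjTranspose_replicateCol,
    trLog_mul_conjTranspose, hinner, trLog_diagonal, Fintype.sum_unique]

theorem trLog_le_xlog_trace {A : Matrix n n ℂ} (hA : A.PosSemidef) :
    trLog A ≤ xlog A.trace.re := by
  rw [trLog_eq_sum_xlog_eigenvalues hA.isHermitian, hA.isHermitian.trace_eq_sum_eigenvalues]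
  exact_mod_cast sum_xlog_le_xlog_sum hA.eigenvalues_nonneg

theorem det_eq_zero_of_xlog_trace_le [Nontrivial n] {A : Matrix n n ℂ} (hA : A.PosSemidef)
    (h : xlog A.trace.re ≤ trLog A) : A.det = 0 := by
  obtain ⟨i, j, hij⟩ := exists_pair_ne n
  rw [trLog_eq_sum_xlog_eigenvalues hA.isHermitian, hA.isHermitian.trace_eq_sum_eigenvalues] at h
  have hzero := mul_eq_zero_of_xlog_sum_le hA.eigenvalues_nonneg (by exact_mod_cast h) hij
  rw [hA.isHermitian.det_eq_prod_eigenvalues, Finset.prod_eq_zero_iff]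
  rcases mul_eq_zero.1 hzero with hi | hj
  · exact ⟨i, Finset.mem_univ i, by simp [hi]⟩
  · exact ⟨j, Finset.mem_univ j, by simp [hj]⟩

theorem trLog_eq_xlog_trace_of_det_eq_zero {A : Matrix (Fin 2) (Fin 2) ℂ} (hA : A.IsHermitian)
    (h : A.det = 0) : trLog A = xlog A.trace.re := by
  rw [trLog_eq_sum_xlog_eigenvalues hA, hA.trace_eq_sum_eigenvalues]
  rw [hA.det_eq_prod_eigenvalues, Fin.prod_univ_two, mul_eq_zero] at h
  rcases h with h | h <;> simp [RCLike.ofReal_eq_zero.1 h, xlog_zero]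

section Superadditivity

variable {A B : Matrix n n ℂ} (hA : A.PosSemidef) (hB : B.PosSemidef)
include hA hB

theorem exists_gram_add :
    ∃ G : Matrix (n ⊕ n) (n ⊕ n) ℂ, G.PosSemidef ∧ trLog G = trLog (A + B) ∧
      ∑ i, xlog (G i i).re = trLog A + trLog B ∧ (G.IsDiag → A * B = 0) := by
  obtain ⟨Y, hYA, hYdiag⟩ := exists_mul_conjTranspose_eq hA
  obtain ⟨Z, hZB, hZdiag⟩ := exists_mul_conjTranspose_eq hB
  have hsum : fromCols Y Z * (fromCols Y Z)ᴴ = A + B := by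
    rw [conjTranspose_fromCols_eq_fromRows_conjTranspose, fromCols_mul_fromRows, hYA, hZB]
  have hgram : (fromCols Y Z)ᴴ * fromCols Y Z = fromBlocks (Yᴴ * Y) (Yᴴ * Z) (Zᴴ * Y) (Zᴴ * Z) := by
    rw [conjTranspose_fromCols_eq_fromRows_conjTranspose, fromRows_mul_fromCols]
  refine ⟨(fromCols Y Z)ᴴ * fromCols Y Z, posSemidef_conjTranspose_mul_self _, ?_, ?_,
    fun hdiag => ?_⟩
  · rw [← trLog_mul_conjTranspose, hsum]
  · rw [hgram, hYdiag, hZdiag, trLog_eq_sum_xlog_eigenvalues hA.isHermitian,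
      trLog_eq_sum_xlog_eigenvalues hB.isHermitian]
    simp
  · have hYZ : Yᴴ * Z = 0 := by
      ext i j
      simpa [hgram] using hdiag (Sum.inl_ne_inr (a := i) (b := j))
    rw [← hYA, ← hZB, Matrix.mul_assoc, ← Matrix.mul_assoc Yᴴ, hYZ, Matrix.zero_mul,
      Matrix.mul_zero]

theorem trLog_add_trLog_le : trLog A + trLog B ≤ trLog (A + B) := by
  obtain ⟨G, hG, htrLog, hdiag, -⟩ := exists_gram_add hA hB
  rw [← htrLog, ← hdiag, trLog_eq_sum_xlog_eigenvalues hG.isHermitian]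
  exact sum_map_diag_le_sum_map_eigenvalues _ strictConvexOn_xlog.convexOn hG.eigenvalues_nonneg

theorem mul_eq_zero_of_trLog_add_le (h : trLog (A + B) ≤ trLog A + trLog B) : A * B = 0 := by
  obtain ⟨G, hG, htrLog, hdiag, horth⟩ := exists_gram_add hA hB
  rw [← htrLog, ← hdiag, trLog_eq_sum_xlog_eigenvalues hG.isHermitian] at h
  exact horth (isDiag_of_sum_map_eigenvalues_le _ strictConvexOn_xlog hG.eigenvalues_nonneg h)

end Superadditivity

end TrLog

section Bipartite

variable {l m n : Type*} [Fintype m]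

theorem traceFst_sum {ι : Type*} (s : Finset ι)
    (ρ : ι → Matrix (m × n) (m × n) ℂ) : traceFst (∑ i ∈ s, ρ i) = ∑ i ∈ s, traceFst (ρ i) := by
  ext x y
  simpa [traceFst, Matrix.sum_apply] using Finset.sum_comm

/-- The coefficient matrix of a vector of a bipartite system. -/
def coeff (v : m × n → ℂ) : Matrix m n ℂ := of (Function.curry v)

theorem traceFst_ketBra (v : m × n → ℂ) :
    traceFst (ketBra v) = (coeff v)ᵀ * (coeff v)ᵀᴴ := by
  ext x y
  simp [traceFst, ketBra, coeff, vecMulVec_apply, Matrix.mul_apply]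

theorem posSemidef_traceFst_ketBra [Finite n] (v : m × n → ℂ) :
    (traceFst (ketBra v)).PosSemidef := by
  rw [traceFst_ketBra]
  exact posSemidef_self_mul_conjTranspose _

theorem eq_zero_of_traceFst_ketBra_eq_zero [Finite n] {v : m × n → ℂ}
    (h : traceFst (ketBra v) = 0) : v = 0 := by
  cases nonempty_fintype n
  have hsum : ∑ x, ‖v x‖ ^ 2 = 0 := by
    rw [← Complex.ofReal_eq_zero, ← trace_ketBra, ← trace_traceFst, h, trace_zero]
  funext x
  simpa using (Finset.sum_eq_zero_iff_of_nonneg fun y _ => sq_nonneg ‖v y‖).1 hsum x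
    (Finset.mem_univ x)

theorem sum_ketBra_row (M : Matrix m n ℂ) : ∑ i, ketBra (M.row i) = Mᵀ * Mᵀᴴ := by
  ext x y
  simp [ketBra, vecMulVec_apply, Matrix.mul_apply, Matrix.sum_apply]

theorem trLog_sum_ketBra_row [Fintype n] [DecidableEq n] {M : Matrix m n ℂ}
    (hM : (M * Mᴴ).IsDiag) :
    trLog (∑ i, ketBra (M.row i)) = ∑ i, trLog (ketBra (M.row i)) := by
  classical
  have hgram : Mᵀᴴ * Mᵀ = diagonal fun i => (((ketBra (M.row i)).trace.re : ℝ) : ℂ) := by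
    have htranspose : Mᵀᴴ * Mᵀ = (M * Mᴴ)ᵀ := by
      ext i j
      simp [Matrix.mul_apply, mul_comm]
    rw [htranspose, ← hM.diagonal_diag, diagonal_transpose]
    congr 1 with i
    rw [trace_ketBra, Complex.ofReal_re]
    simp [Matrix.mul_apply, Complex.mul_conj']
  rw [sum_ketBra_row, trLog_mul_conjTranspose, hgram, trLog_diagonal]
  simp only [trLog_ketBra]

/-- The unnormalised vector of the second system after outcome `i` of a measurement of the first
system in the basis given by `U`. -/
def branch (U : Matrix l m ℂ) (v : m × n → ℂ) (i : l) : n → ℂ := (U * coeff v).row i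

theorem coeff_branch {p : Type*} (U : Matrix l m ℂ) (v : m × (n × p) → ℂ)
    (i : l) : coeff (branch U v i) = ∑ k, U i k • coeff fun x => v (k, x) := by
  ext
  simp [coeff, branch, Matrix.mul_apply, Matrix.sum_apply]

theorem branch_eq_smul {v : m × n → ℂ} {a : m → ℂ} {b : n → ℂ} (hab : ∀ y, v y = a y.1 * b y.2)
    (U : Matrix l m ℂ) (i : l) : branch U v i = (U *ᵥ a) i • b := by
  ext x
  simp [branch, coeff, hab, Matrix.mul_apply, Matrix.mulVec, dotProduct, Finset.sum_mul, mul_assoc]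

theorem sum_ketBra_branch [DecidableEq m] {U : Matrix m m ℂ} (hU : U ∈ unitaryGroup m ℂ)
    (v : m × n → ℂ) : ∑ i, ketBra (branch U v i) = traceFst (ketBra v) := by
  have hUt : Uᵀ * Uᵀᴴ = 1 :=
    mem_unitaryGroup_iff.1 (transpose_mem_unitaryGroup_iff.2 hU)
  simp only [branch]
  rw [sum_ketBra_row, transpose_mul, conjTranspose_mul, Matrix.mul_assoc,
    ← Matrix.mul_assoc Uᵀ, hUt, Matrix.one_mul, traceFst_ketBra]

theorem exists_eq_mul_of_branch_eq_zero {v : Fin 2 × n → ℂ} {U : Matrix (Fin 2) (Fin 2) ℂ}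
    (hU : U ∈ unitaryGroup (Fin 2) ℂ) {i : Fin 2} (hi : branch U v i = 0) :
    ∃ (a : Fin 2 → ℂ) (b : n → ℂ), ∀ y, v y = a y.1 * b y.2 := by
  have hinv : ∀ y, v y = ∑ j, star (U j y.1) * branch U v j y.2 := fun y => by
    have hcoeff : coeff v = star U * (U * coeff v) := by
      rw [← Matrix.mul_assoc, mem_unitaryGroup_iff'.1 hU, Matrix.one_mul]
    exact congrFun (congrFun hcoeff y.1) y.2
  obtain ⟨j, hj⟩ := (by decide : ∀ i : Fin 2, ∃ j, ∀ k ≠ j, k = i) i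
  refine ⟨fun k => star (U j k), branch U v j, fun y => ?_⟩
  rw [hinv, Finset.sum_eq_single j (fun k _ hk => by simp [hj k hk, hi]) (by simp)]

theorem exists_unitary_mul_conjTranspose_isDiag [DecidableEq m] [Fintype n] (M : Matrix m n ℂ) :
    ∃ U ∈ unitaryGroup m ℂ, (U * M * (U * M)ᴴ).IsDiag := by
  have hherm : (M * Mᴴ).IsHermitian := isHermitian_mul_conjTranspose_self M
  refine ⟨_, (star hherm.eigenvectorUnitary).2, ?_⟩
  have hdiag := hherm.conjStarAlgAut_star_eigenvectorUnitary
  rw [Unitary.conjStarAlgAut_apply] at hdiag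
  generalize star hherm.eigenvectorUnitary = U at hdiag ⊢
  have hconj : U.1 * M * (U.1 * M)ᴴ = U.1 * (M * Mᴴ) * star U.1 := by
    simp only [conjTranspose_mul, star_eq_conjTranspose, Matrix.mul_assoc]
  rw [hconj]
  exact hdiag ▸ isDiag_diagonal _

/-- The entanglement entropy of the normalisation of `v`, weighted by the squared norm of `v`. The
formula needs no division and gives `0` for `v = 0`. -/
noncomputable def entanglement [Fintype n] [DecidableEq n] (v : m × n → ℂ) : ℝ :=
  xlog (ketBra v).trace.re - trLog (traceFst (ketBra v))

theorem entanglement_nonneg [Fintype n] [DecidableEq n] (v : m × n → ℂ) : 0 ≤ entanglement v := by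
  rw [entanglement, ← trace_traceFst]
  exact sub_nonneg.2 (trLog_le_xlog_trace (posSemidef_traceFst_ketBra v))

theorem entanglement_smul [Fintype n] [DecidableEq n] (c : ℂ) (v : m × n → ℂ) :
    entanglement (c • v) = ‖c‖ ^ 2 * entanglement v := by
  simp only [entanglement, ketBra_smul, traceFst_smul, trace_smul, Complex.smul_re, smul_eq_mul,
    trLog_smul (posSemidef_traceFst_ketBra v).isHermitian, trace_traceFst, xlog_mul]
  ring

theorem entanglement_eq_zero_of_det_eq_zero {v : m × Fin 2 → ℂ}
    (h : (traceFst (ketBra v)).det = 0) : entanglement v = 0 := by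
  rw [entanglement, trLog_eq_xlog_trace_of_det_eq_zero (posSemidef_traceFst_ketBra v).isHermitian h,
    trace_traceFst, sub_self]

theorem det_coeff_eq_zero_of_entanglement_eq_zero [DecidableEq m] [Nontrivial m] {v : m × m → ℂ}
    (h : entanglement v = 0) : (coeff v).det = 0 := by
  rw [entanglement, ← trace_traceFst, sub_eq_zero] at h
  have hdet := det_eq_zero_of_xlog_trace_le (posSemidef_traceFst_ketBra v) h.le
  rw [traceFst_ketBra, det_mul, det_conjTranspose, det_transpose] at hdet
  simpa using hdet

end Bipartite

section Control

variable {U : Matrix (Fin 2) (Fin 2) ℂ} {χ : Fin 2 × (Fin 2 × Fin 2) → ℂ}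

theorem submatrix_rotate_ketBra (U : Matrix (Fin 2) (Fin 2) ℂ)
    (χ : Fin 2 × (Fin 2 × Fin 2) → ℂ) (i : Fin 2) :
    (rotate U (ketBra χ)).submatrix (Prod.mk i) (Prod.mk i) = ketBra (branch U χ i) := by
  have hvec : (U ⊗ₖ (1 : Matrix (Fin 2 × Fin 2) (Fin 2 × Fin 2) ℂ)) *ᵥ χ =
      fun y => branch U χ y.1 y.2 := by
    ext y
    simp [branch, coeff, Matrix.mul_apply, Matrix.mulVec, dotProduct, Fintype.sum_prod_type,
      Matrix.one_apply]
  rw [rotate, ketBra, mul_vecMulVec, vecMulVec_mul, ← star_mulVec, hvec]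
  rfl

theorem avgCapacity_ketBra (hU : U ∈ unitaryGroup (Fin 2) ℂ) (hχ : (ketBra χ).trace.re = 1) :
    avgCapacity U (ketBra χ) = 1 + ∑ i, entanglement (branch U χ i) := by
  have hprob : ∑ i, (ketBra (branch U χ i)).trace.re = 1 := by
    rw [← Complex.re_sum, ← trace_sum, sum_ketBra_branch hU, trace_traceFst, hχ]
  rw [← hprob, ← Finset.sum_add_distrib, avgCapacity]
  refine Finset.sum_congr rfl fun i _ => ?_
  rw [outcomeProb_mul_capacity (posSemidef_ketBra χ), outcomeProb_eq_trace,
    submatrix_rotate_ketBra, trLog_ketBra, entanglement, add_sub_assoc]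

theorem capacity_traceFst_ketBra (χ : Fin 2 × (Fin 2 × Fin 2) → ℂ) :
    capacity (traceFst (ketBra χ)) =
      1 - trLog (traceFst (traceFst (ketBra χ))) + trLog (traceFst (ketBra χ)) := by
  have hherm := (posSemidef_traceFst_ketBra χ).isHermitian
  rw [capacity, entropy_eq_neg_trLog hherm, entropy_eq_neg_trLog (isHermitian_traceFst hherm)]
  ring

theorem avgCapacity_sub_capacity (hU : U ∈ unitaryGroup (Fin 2) ℂ)
    (hχ : (ketBra χ).trace.re = 1) :
    avgCapacity U (ketBra χ) - capacity (traceFst (ketBra χ)) =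
      ∑ i, entanglement (branch U χ i) +
        (trLog (traceFst (traceFst (ketBra χ))) - trLog (traceFst (ketBra χ))) := by
  rw [avgCapacity_ketBra hU hχ, capacity_traceFst_ketBra]
  ring

theorem avgCapacity_sub_capacity_of_isDiag (hU : U ∈ unitaryGroup (Fin 2) ℂ)
    (hχ : (ketBra χ).trace.re = 1) (hdiag : (U * coeff χ * (U * coeff χ)ᴴ).IsDiag) :
    avgCapacity U (ketBra χ) - capacity (traceFst (ketBra χ)) =
      trLog (∑ i, traceFst (ketBra (branch U χ i))) -
        ∑ i, trLog (traceFst (ketBra (branch U χ i))) := by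
  have hpure : trLog (traceFst (ketBra χ)) = ∑ i, xlog (ketBra (branch U χ i)).trace.re := by
    rw [← sum_ketBra_branch hU]
    simp only [← trLog_ketBra]
    exact trLog_sum_ketBra_row hdiag
  rw [avgCapacity_sub_capacity hU hχ, hpure, ← traceFst_sum, sum_ketBra_branch hU]
  simp only [entanglement, Finset.sum_sub_distrib]
  ring

theorem capacity_le_avgCapacity_of_isDiag (hU : U ∈ unitaryGroup (Fin 2) ℂ)
    (hχ : (ketBra χ).trace.re = 1) (hdiag : (U * coeff χ * (U * coeff χ)ᴴ).IsDiag) :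
    capacity (traceFst (ketBra χ)) ≤ avgCapacity U (ketBra χ) := by
  rw [← sub_nonneg, avgCapacity_sub_capacity_of_isDiag hU hχ hdiag]
  simp only [Fin.sum_univ_two]
  exact sub_nonneg.2 (trLog_add_trLog_le (posSemidef_traceFst_ketBra _)
    (posSemidef_traceFst_ketBra _))

theorem avgCapacity_le_controlledCapacity (hU : U ∈ unitaryGroup (Fin 2) ℂ)
    (χ : Fin 2 × (Fin 2 × Fin 2) → ℂ) :
    avgCapacity U (ketBra χ) ≤ controlledCapacity (ketBra χ) :=
  (controlledCapacity_isGreatest (posSemidef_ketBra χ)).2 ⟨⟨U, hU⟩, rfl⟩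

theorem capacity_le_controlledCapacity (hχ : (ketBra χ).trace.re = 1) :
    capacity (traceFst (ketBra χ)) ≤ controlledCapacity (ketBra χ) := by
  obtain ⟨U, hU, hdiag⟩ := exists_unitary_mul_conjTranspose_isDiag (coeff χ)
  exact (capacity_le_avgCapacity_of_isDiag hU hχ hdiag).trans
    (avgCapacity_le_controlledCapacity hU χ)

theorem avgCapacity_eq_capacity_of_eq_mul (hU : U ∈ unitaryGroup (Fin 2) ℂ)
    (hχ : (ketBra χ).trace.re = 1) {a : Fin 2 → ℂ} {b : Fin 2 × Fin 2 → ℂ}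
    (hab : ∀ y, χ y = a y.1 * b y.2) :
    avgCapacity U (ketBra χ) = capacity (traceFst (ketBra χ)) := by
  set c : ℝ := ∑ i, ‖(U *ᵥ a) i‖ ^ 2 with hc
  have hreduced : traceFst (ketBra χ) = c • ketBra b := by
    rw [← sum_ketBra_branch hU, hc, Finset.sum_smul]
    simp only [branch_eq_smul hab, ketBra_smul]
  have hent : ∑ i, entanglement (branch U χ i) = c * entanglement b := by
    rw [hc, Finset.sum_mul]
    simp only [branch_eq_smul hab, entanglement_smul]
  rw [← sub_eq_zero, avgCapacity_sub_capacity hU hχ, hent, hreduced, traceFst_smul,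
    trLog_smul (posSemidef_traceFst_ketBra b).isHermitian,
    trLog_smul (posSemidef_ketBra b).isHermitian, trLog_ketBra, trace_traceFst, entanglement]
  ring

theorem controlledCapacity_eq_capacity_of_eq_mul (hχ : (ketBra χ).trace.re = 1) {a : Fin 2 → ℂ}
    {b : Fin 2 × Fin 2 → ℂ} (hab : ∀ y, χ y = a y.1 * b y.2) :
    controlledCapacity (ketBra χ) = capacity (traceFst (ketBra χ)) := by
  obtain ⟨U, hU⟩ := (controlledCapacity_isGreatest (posSemidef_ketBra χ)).1
  exact hU.symm.trans (avgCapacity_eq_capacity_of_eq_mul U.2 hχ hab)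

section Converse

variable (hχ : (ketBra χ).trace.re = 1)
  (hle : controlledCapacity (ketBra χ) ≤ capacity (traceFst (ketBra χ)))
  (hU : U ∈ unitaryGroup (Fin 2) ℂ) (hdiag : (U * coeff χ * (U * coeff χ)ᴴ).IsDiag)

include hχ hle hU hdiag

theorem traceFst_ketBra_branch_mul_eq_zero :
    traceFst (ketBra (branch U χ 0)) * traceFst (ketBra (branch U χ 1)) = 0 := by
  have hgain := avgCapacity_sub_capacity_of_isDiag hU hχ hdiag
  simp only [Fin.sum_univ_two] at hgain
  refine mul_eq_zero_of_trLog_add_le (posSemidef_traceFst_ketBra _)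
    (posSemidef_traceFst_ketBra _) ?_
  linarith [avgCapacity_le_controlledCapacity hU χ]

/-- If the diagonal measurement leaves no entanglement, then the reference capacity is at most `1`,
and the entanglement left by any other measurement would exceed it. -/
theorem entanglement_branch_eq_zero (hE : ∀ i, entanglement (branch U χ i) = 0)
    {W : Matrix (Fin 2) (Fin 2) ℂ} (hW : W ∈ unitaryGroup (Fin 2) ℂ) (i : Fin 2) :
    entanglement (branch W χ i) = 0 := by
  have hone : capacity (traceFst (ketBra χ)) ≤ 1 := by
    simpa [avgCapacity_ketBra hU hχ, hE] using capacity_le_avgCapacity_of_isDiag hU hχ hdiag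
  have hsum : ∑ j, entanglement (branch W χ j) ≤ 0 := by
    have hW_le := (avgCapacity_le_controlledCapacity hW χ).trans (hle.trans hone)
    rw [avgCapacity_ketBra hW hχ] at hW_le
    linarith
  exact (Finset.sum_eq_zero_iff_of_nonneg fun j _ => entanglement_nonneg _).1
    (hsum.antisymm (Finset.sum_nonneg fun j _ => entanglement_nonneg _)) i (Finset.mem_univ i)

end Converse

theorem exists_eq_mul_or_forall_entanglement_branch_eq_zero (hχ : (ketBra χ).trace.re = 1)
    (hle : controlledCapacity (ketBra χ) ≤ capacity (traceFst (ketBra χ))) :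
    (∃ (a : Fin 2 → ℂ) (b : Fin 2 × Fin 2 → ℂ), ∀ y, χ y = a y.1 * b y.2) ∨
      ∀ W ∈ unitaryGroup (Fin 2) ℂ, ∀ i, entanglement (branch W χ i) = 0 := by
  obtain ⟨U, hU, hdiag⟩ := exists_unitary_mul_conjTranspose_isDiag (coeff χ)
  have horth := traceFst_ketBra_branch_mul_eq_zero hχ hle hU hdiag
  by_cases hzero : ∃ i, branch U χ i = 0
  · exact Or.inl (exists_eq_mul_of_branch_eq_zero hU hzero.choose_spec)
  push Not at hzero
  have hdet : ∀ i, (traceFst (ketBra (branch U χ i))).det = 0 := by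
    by_contra! ⟨i, hi⟩
    have hunit := (isUnit_iff_isUnit_det _).2 (isUnit_iff_ne_zero.2 hi)
    fin_cases i
    · exact hzero 1 (eq_zero_of_traceFst_ketBra_eq_zero (hunit.mul_right_eq_zero.1 horth))
    · exact hzero 0 (eq_zero_of_traceFst_ketBra_eq_zero (hunit.mul_left_eq_zero.1 horth))
  exact Or.inr fun W hW => entanglement_branch_eq_zero hχ hle hU hdiag
    (fun i => entanglement_eq_zero_of_det_eq_zero (hdet i)) hW

end Control

section CommonFactor

variable {K : Type*} [Field K]

theorem exists_eq_vecMulVec_of_det_eq_zero {M : Matrix (Fin 2) (Fin 2) K} (h : M.det = 0) :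
    ∃ a b : Fin 2 → K, M = vecMulVec a b := by
  obtain ⟨v, hv, hvM⟩ := exists_vecMul_eq_zero_iff.2 h
  have hrel : ∀ j, v 0 * M 0 j + v 1 * M 1 j = 0 := fun j => by
    simpa [Matrix.vecMul, dotProduct] using congrFun hvM j
  by_cases h0 : v 0 = 0
  · have h1 : v 1 ≠ 0 := fun h1 => hv (by ext i; fin_cases i <;> assumption)
    refine ⟨![1, 0], M.row 0, ?_⟩
    ext i j
    fin_cases i
    · simp [vecMulVec_apply]
    · simpa [vecMulVec_apply, h0, h1] using hrel j
  · refine ⟨![-(v 1 / v 0), 1], M.row 1, ?_⟩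
    ext i j
    fin_cases i
    · suffices M 0 j = -(v 1 / v 0) * M 1 j by simpa [vecMulVec_apply] using this
      field_simp
      linear_combination hrel j
    · simp [vecMulVec_apply]

theorem exists_common_factor {N : Fin 2 → Matrix (Fin 2) (Fin 2) K} (hN : ∀ k, (N k).det = 0)
    (hsum : (∑ k, N k).det = 0) :
    (∃ (e : Fin 2 → K) (w : Fin 2 → Fin 2 → K), ∀ k, N k = vecMulVec e (w k)) ∨
      ∃ (e : Fin 2 → K) (w : Fin 2 → Fin 2 → K), ∀ k, N k = vecMulVec (w k) e := by
  choose a b hab using fun k => exists_eq_vecMulVec_of_det_eq_zero (hN k)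
  have hfactor : ∑ k, N k = (of a)ᵀ * of b := by
    ext i j
    simp [hab, vecMulVec_apply, Matrix.mul_apply]
  rw [hfactor, det_mul, det_transpose, mul_eq_zero] at hsum
  rcases hsum with ha | hb
  · obtain ⟨s, e, hse⟩ := exists_eq_vecMulVec_of_det_eq_zero ha
    have hae : ∀ k, a k = s k • e := congrFun hse
    exact Or.inl ⟨e, fun k => s k • b k, fun k => by rw [hab, hae, smul_vecMulVec, vecMulVec_smul]⟩
  · obtain ⟨s, e, hse⟩ := exists_eq_vecMulVec_of_det_eq_zero hb
    have hbe : ∀ k, b k = s k • e := congrFun hse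
    exact Or.inr ⟨e, fun k => s k • a k, fun k => by rw [hab, hbe, smul_vecMulVec, vecMulVec_smul]⟩

end CommonFactor

section Factorization

variable {χ : Fin 2 × (Fin 2 × Fin 2) → ℂ}

/-- The Hadamard gate, whose first outcome is an equal superposition of the two basis states. -/
noncomputable def hadamardGate : Matrix (Fin 2) (Fin 2) ℂ :=
  ((√2)⁻¹ : ℝ) • !![1, 1; 1, -1]

theorem hadamardGate_mem_unitaryGroup : hadamardGate ∈ unitaryGroup (Fin 2) ℂ := by
  have hsq : (√2)⁻¹ * (√2)⁻¹ = (1 / 2 : ℝ) := by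
    rw [← mul_inv, Real.mul_self_sqrt zero_le_two, one_div]
  rw [mem_unitaryGroup_iff, hadamardGate, star_smul, Matrix.smul_mul, Matrix.mul_smul, smul_smul,
    star_trivial, hsq]
  ext i j
  fin_cases i <;> fin_cases j <;>
    simp only [Matrix.smul_apply, Matrix.mul_apply, Fin.sum_univ_two, Matrix.star_apply] <;>
    norm_num

theorem hadamardGate_zero (k : Fin 2) : hadamardGate 0 k = ((√2)⁻¹ : ℝ) := by
  fin_cases k <;> simp [hadamardGate]

theorem exists_eq_mul_of_forall_entanglement_branch_eq_zero
    (h : ∀ W ∈ unitaryGroup (Fin 2) ℂ, ∀ i, entanglement (branch W χ i) = 0) :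
    (∃ (a : Fin 2 → ℂ) (b : Fin 2 × Fin 2 → ℂ), ∀ y, χ y = a y.2.1 * b (y.1, y.2.2)) ∨
      ∃ (a : Fin 2 → ℂ) (b : Fin 2 × Fin 2 → ℂ), ∀ y, χ y = a y.2.2 * b (y.2.1, y.1) := by
  set N : Fin 2 → Matrix (Fin 2) (Fin 2) ℂ := fun k => coeff fun x => χ (k, x)
  have hdet : ∀ W ∈ unitaryGroup (Fin 2) ℂ, ∀ i, (∑ k, W i k • N k).det = 0 := fun W hW i => by
    rw [← coeff_branch]
    exact det_coeff_eq_zero_of_entanglement_eq_zero (h W hW i)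
  have hN : ∀ k, (N k).det = 0 := fun k => by
    simpa [Matrix.one_apply] using hdet 1 (one_mem _) k
  have hsum : (∑ k, N k).det = 0 := by
    have hsuper := hdet _ hadamardGate_mem_unitaryGroup 0
    simp only [hadamardGate_zero, ← Finset.smul_sum] at hsuper
    rw [det_smul] at hsuper
    exact (mul_eq_zero.1 hsuper).resolve_left (by simp)
  have hχ : ∀ y, χ y = N y.1 y.2.1 y.2.2 := fun _ => rfl
  rcases exists_common_factor hN hsum with ⟨e, w, hew⟩ | ⟨e, w, hew⟩
  · exact Or.inl ⟨e, fun z => w z.1 z.2, fun y => by rw [hχ, hew, vecMulVec_apply]⟩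
  · exact Or.inr ⟨e, fun z => w z.2 z.1, fun y => by rw [hχ, hew, vecMulVec_apply, mul_comm]⟩

end Factorization

section Arrange

variable {σ : Equiv.Perm (Fin 3)} {ψ : EuclideanSpace ℂ (Fin 3 → Fin 2)}

/-- The relabelling of the basis vectors of three qubits behind `arrange`: the labels of qubits
`σ 0`, `σ 1` and `σ 2`, in this order. -/
def arrangeEquiv (σ : Equiv.Perm (Fin 3)) : (Fin 3 → Fin 2) ≃ Fin 2 × (Fin 2 × Fin 2) where
  toFun x := (x (σ 0), x (σ 1), x (σ 2))
  invFun y q := ![y.1, y.2.1, y.2.2] (σ.symm q)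
  left_inv x := by
    funext q
    obtain ⟨k, rfl⟩ := σ.surjective q
    fin_cases k <;> simp
  right_inv y := by simp

/-- The state vector `ψ` with its qubits in the order (Charlie, Alice, Bob). -/
def arrangeVec (σ : Equiv.Perm (Fin 3)) (ψ : EuclideanSpace ℂ (Fin 3 → Fin 2)) :
    Fin 2 × (Fin 2 × Fin 2) → ℂ := fun y => ψ ((arrangeEquiv σ).symm y)

theorem arrangeVec_apply (σ : Equiv.Perm (Fin 3)) (ψ : EuclideanSpace ℂ (Fin 3 → Fin 2))
    (x : Fin 3 → Fin 2) : arrangeVec σ ψ (x (σ 0), x (σ 1), x (σ 2)) = ψ x :=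
  congrArg ψ ((arrangeEquiv σ).symm_apply_apply x)

theorem arrange_pureState (σ : Equiv.Perm (Fin 3)) (ψ : EuclideanSpace ℂ (Fin 3 → Fin 2)) :
    arrange σ (pureState ψ) = ketBra (arrangeVec σ ψ) := rfl

theorem trace_ketBra_arrangeVec (σ : Equiv.Perm (Fin 3)) (hψ : ‖ψ‖ = 1) :
    (ketBra (arrangeVec σ ψ)).trace.re = 1 := by
  rw [trace_ketBra, Complex.ofReal_re]
  exact (Equiv.sum_comp (arrangeEquiv σ).symm fun x => ‖ψ x‖ ^ 2).trans
    (by rw [← EuclideanSpace.norm_sq_eq, hψ, one_pow])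

theorem controlPower_nonneg (σ : Equiv.Perm (Fin 3)) (hψ : ‖ψ‖ = 1) :
    0 ≤ controlPower σ (pureState ψ) := by
  rw [controlPower, arrange_pureState]
  exact sub_nonneg.2 (capacity_le_controlledCapacity (trace_ketBra_arrangeVec σ hψ))

theorem controlPower_eq_zero_of_eq_mul (hψ : ‖ψ‖ = 1) {a : Fin 2 → ℂ} {b : Fin 2 × Fin 2 → ℂ}
    (hab : ∀ x : Fin 3 → Fin 2, ψ x = a (x (σ 0)) * b (x (σ 1), x (σ 2))) :
    controlPower σ (pureState ψ) = 0 := by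
  have hχ : ∀ y, arrangeVec σ ψ y = a y.1 * b y.2 :=
    (arrangeEquiv σ).surjective.forall.2 fun x => (arrangeVec_apply σ ψ x).trans (hab x)
  rw [controlPower, arrange_pureState, sub_eq_zero]
  exact controlledCapacity_eq_capacity_of_eq_mul (trace_ketBra_arrangeVec σ hψ) hχ

theorem isBiseparable_of_controlPower_eq_zero (hψ : ‖ψ‖ = 1)
    (h : controlPower σ (pureState ψ) = 0) : IsBiseparable ψ := by
  rw [controlPower, arrange_pureState, sub_eq_zero] at h
  have happly := arrangeVec_apply σ ψ
  rcases exists_eq_mul_or_forall_entanglement_branch_eq_zero (trace_ketBra_arrangeVec σ hψ) h.le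
    with ⟨a, b, hC⟩ | hE
  · exact ⟨σ, a, b, fun x => by rw [← happly, hC]⟩
  rcases exists_eq_mul_of_forall_entanglement_branch_eq_zero hE with ⟨a, b, hA⟩ | ⟨a, b, hB⟩
  · have hfix : Equiv.swap (0 : Fin 3) 1 2 = 2 := by decide
    exact ⟨σ * Equiv.swap 0 1, a, b, fun x => by rw [← happly, hA]; simp [hfix]⟩
  · have hfix : Equiv.swap (0 : Fin 3) 2 1 = 1 := by decide
    exact ⟨σ * Equiv.swap 0 2, a, b, fun x => by rw [← happly, hB]; simp [hfix]⟩

theorem IsFullySeparable.isBiseparable (h : IsFullySeparable ψ) : IsBiseparable ψ := by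
  obtain ⟨a, b, c, habc⟩ := h
  exact ⟨1, a, fun y => b y.1 * c y.2, fun x => (habc x).trans (mul_assoc _ _ _)⟩

end Arrange

end DenseCoding

theorem proposition3 (ψ : EuclideanSpace ℂ (Fin 3 → Fin 2)) (hψ : ‖ψ‖ = 1) :
    DenseCoding.minControlPower (DenseCoding.pureState ψ) = 0 ↔
      DenseCoding.IsBiseparable ψ ∨ DenseCoding.IsFullySeparable ψ := by
  constructor
  · intro hmin
    obtain ⟨σ, -, hσ⟩ := Finset.exists_mem_eq_inf' Finset.univ_nonempty
      fun σ : Equiv.Perm (Fin 3) => DenseCoding.controlPower σ (DenseCoding.pureState ψ)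
    exact Or.inl (DenseCoding.isBiseparable_of_controlPower_eq_zero hψ (hσ.symm.trans hmin))
  · intro hsep
    obtain ⟨σ, a, b, hab⟩ := hsep.elim id DenseCoding.IsFullySeparable.isBiseparable
    have hσ := DenseCoding.controlPower_eq_zero_of_eq_mul hψ hab
    exact ((Finset.inf'_le _ (Finset.mem_univ σ)).trans_eq hσ).antisymm
      (Finset.le_inf' _ _ fun τ _ => DenseCoding.controlPower_nonneg τ hψ)
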